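/- Let $\nu>-1$ and let $n\ge 2$ be an integer. Let $$J_\nu(z)=\Big(\frac z2\Big)^{\nu}\sum_{k=0}^\infty \frac{(-\frac14 z^2)^k}{k!\,\Gamma(\nu+k+1)},\qquad z>0,$$ be the Bessel function of the first kind, and let $0<\lambda_{1,\nu}<\lambda_{2,\nu}<\dots$ be its successive positive zeros. For $x\in(0,1)$ and $m\ge1$ put $$R^\nu(x)=\lambda_{1,\nu}\frac{J_{\nu+1}(\lambda_{1,\nu}x)}{J_\nu(\lambda_{1,\nu}x)},\qquad \phi_m^\nu(x)=\frac{\sqrt2}{|J_{\nu+1}(\lambda_{m,\nu})|}\,x^{-\nu}J_\nu(\lambda_{m,\nu}x),$$ $$\psi_m^\nu(x)=x^{\nu+1/2}\phi_m^\nu(x),\qquad \varphi_m^\nu(x)=\frac{\phi_m^\nu(x)}{\phi_1^\nu(x)},$$ and define the first order differential operators $$d_\nu=\frac{d}{dx},\qquad \delta_\nu=\frac{d}{dx}+R^\nu(x),\qquad \mathbb D_\nu=\frac{d}{dx}-\frac{\nu+1/2}{x}+R^\nu(x).$$ For real functions $f,g$ write $f(x)\simeq g(x)$ as $x\to 0^+$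 (respectively $x\to1^-$) if there are constants $C_1,C_2>0$ such that $f(x)\le C_1\,g(x)$ and $g(x)\le C_2\,f(x)$ for all $x\in(0,1)$ sufficiently close to $0$ (respectively $1$); the constants may depend on $\nu$ and $n$, and $g$ may be negative. Then each of the functions $d_\nu\varphi_n^\nu$, $\delta_\nu\phi_n^\nu$ and $\mathbb D_\nu\psi_n^\nu$ is smooth ($C^\infty$) on $(0,1)$. Further, one has $$d_\nu\varphi_n^\nu(x)\simeq\begin{cases}-x,& x\to0^+,\\ (-1)^{n+1}(1-x),& x\to1^-,\end{cases}$$ $$\delta_\nu\phi_n^\nu(x)\simeq\begin{cases}-x,& x\to0^+,\\ (-1)^{n+1}(1-x)^2,& x\to1^-,\end{cases}$$ $$\mathbb D_\nu\psi_n^\nu(x)\simeq\begin{cases}-x^{\nu+3/2},& x\to0^+,\\ (-1)^{n+1}(1-x)^2,& x\to1^-.\end{cases}$$ -/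

import Mathlib

open Filter Topology Set
open scoped ContDiff

noncomputable section

namespace FourierBessel

/-- Bessel function of the first kind `J_ν(z)`, by its power series; used for `ν > -1`, `z > 0`. -/
def besselJ (ν z : ℝ) : ℝ :=
  (z / 2) ^ ν * ∑' k : ℕ, (-(1 / 4) * z ^ 2) ^ k / ((k.factorial : ℝ) * Real.Gamma (ν + k + 1))

/-- For `n ≥ 1`, `besselZero ν n` is the `n`-th successive positive zero `λ_{n,ν}` of `J_ν`:
the first zero to the right of the previous one. The value at `n = 0` only starts the recursion. -/
def besselZero (ν : ℝ) : ℕ → ℝ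
  | 0 => 0
  | n + 1 => sInf {x : ℝ | besselZero ν n < x ∧ besselJ ν x = 0}

/-- `R_n^ν(x) = λ_{n,ν} J_{ν+1}(λ_{n,ν} x) / J_ν(λ_{n,ν} x)`. -/
def R (ν : ℝ) (n : ℕ) (x : ℝ) : ℝ :=
  besselZero ν n * (besselJ (ν + 1) (besselZero ν n * x) / besselJ ν (besselZero ν n * x))

/-- The natural measure Fourier-Bessel functions `ϕ_n^ν`. -/
def phi (ν : ℝ) (n : ℕ) (x : ℝ) : ℝ :=
  √2 / |besselJ (ν + 1) (besselZero ν n)| * x ^ (-ν) * besselJ ν (besselZero ν n * x)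

/-- The Lebesgue measure Fourier-Bessel functions `ψ_n^ν = x^{ν+1/2} ϕ_n^ν`. -/
def psi (ν : ℝ) (n : ℕ) (x : ℝ) : ℝ :=
  x ^ (ν + 1 / 2) * phi ν n x

/-- The essential measure Fourier-Bessel functions `φ_n^ν = ϕ_n^ν / ϕ_1^ν`. -/
def varphi (ν : ℝ) (n : ℕ) (x : ℝ) : ℝ :=
  phi ν n x / phi ν 1 x

/-- The essential measure derivative `d_ν = d/dx` (it does not depend on `ν`). -/
def dEss (_ν : ℝ) (f : ℝ → ℝ) (x : ℝ) : ℝ :=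
  deriv f x

/-- The natural measure derivative `δ_ν = d/dx + R^ν(x)`, where `R^ν = R_1^ν`. -/
def dNat (ν : ℝ) (f : ℝ → ℝ) (x : ℝ) : ℝ :=
  deriv f x + R ν 1 x * f x

/-- The Lebesgue measure derivative `𝔻_ν = d/dx - (ν+1/2)/x + R^ν(x)`. -/
def dLeb (ν : ℝ) (f : ℝ → ℝ) (x : ℝ) : ℝ :=
  deriv f x - (ν + 1 / 2) / x * f x + R ν 1 x * f x

/-- `f ≲ g` along the filter `l`: eventually `f ≤ C g`, for some constant `C > 0`. -/
def LesssimAlong (l : Filter ℝ) (f g : ℝ → ℝ) : Prop :=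
  ∃ C : ℝ, 0 < C ∧ ∀ᶠ x in l, f x ≤ C * g x

/-- `f ≃ g` along the filter `l`: both `f ≲ g` and `g ≲ f`. Here `f` and `g` may be negative;
in that case this says that `-f` and `-g` are comparable. -/
def SimeqAlong (l : Filter ℝ) (f g : ℝ → ℝ) : Prop :=
  LesssimAlong l f g ∧ LesssimAlong l g f

end FourierBessel

end

/-! Write `J_ν(z) = (z/2)^ν F_ν(z)` with `F_ν` smooth and even, and let `a = λ_1`, `b = λ_n`. The
factor `x^{-ν}` in `ϕ_n` cancels the power, so `ϕ_n` is a positive constant times `F_ν(b x)`. Since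
`R^ν = -ϕ_1'/ϕ_1`, one has `δ_ν f = ϕ_1 (f/ϕ_1)'`, and `𝔻_ν` is `δ_ν` conjugated by `x^{ν+1/2}`. All
three functions are therefore, up to explicit factors, one Wronskian: they equal a positive constant
times `x W(x)` divided by `F_ν(a x)^2`, `F_ν(a x)`, and `F_ν(a x)` with an extra factor `x^{ν+1/2}`.
As `F_ν(a x) > 0` on `(0,1)`, smoothness follows.

At `0`, `W` tends to a positive multiple of `a^2 - b^2 < 0`. At `1`, the Sturm–Liouville identity
makes `(x^{2ν+2} W)'` a multiple of `F_ν(a x) F_ν(b x)`, a product of two functions with simple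
zeros at `1`; hence `W` vanishes to third order, and dividing by `F_ν(a x)^2` or `F_ν(a x)` leaves
order one or two. The sign `(-1)^{n+1}` is that of `F_{ν+1}(λ_n)`.

This needs the zeros of `J_ν`, defined by successive infima, to exist, to be isolated and simple,
and to alternate in sign: existence is by Sturm comparison, simplicity by a monotone energy, the
rest by induction. -/

namespace FourierBessel

/-! ### Power series, recurrence and smoothness of the entire factor of `J_ν` -/

/-- The entire function `s ↦ ∑ s ^ k / (k! Γ(ν + k + 1))`. -/
noncomputable def besselSeries (ν s : ℝ) : ℝ :=
  ∑' k : ℕ, s ^ k / ((k.factorial : ℝ) * Real.Gamma (ν + k + 1))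

/-- The even entire factor of `J_ν`, so that `J_ν(z) = (z / 2) ^ ν * besselEntire ν z`. -/
noncomputable def besselEntire (ν z : ℝ) : ℝ :=
  besselSeries ν (-(1 / 4) * z ^ 2)

theorem besselJ_eq (ν z : ℝ) : besselJ ν z = (z / 2) ^ ν * besselEntire ν z := rfl

theorem Gamma_add_nat_pos {ν : ℝ} (hν : -1 < ν) (k : ℕ) : 0 < Real.Gamma (ν + k + 1) :=
  Real.Gamma_pos_of_pos (by have : (0 : ℝ) ≤ k := k.cast_nonneg; linarith)

theorem Gamma_add_nat_succ {ν : ℝ} (hν : -1 < ν) (k : ℕ) :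
    Real.Gamma (ν + (k + 1 : ℕ) + 1) = (ν + k + 1) * Real.Gamma (ν + k + 1) := by
  have : (0 : ℝ) ≤ k := k.cast_nonneg
  rw [← Real.Gamma_add_one (by linarith)]
  push_cast
  ring_nf

theorem summable_besselSeries {ν : ℝ} (hν : -1 < ν) (s : ℝ) :
    Summable fun k : ℕ => s ^ k / ((k.factorial : ℝ) * Real.Gamma (ν + k + 1)) := by
  rcases eq_or_ne s 0 with rfl | hs
  · refine summable_of_ne_finset_zero (s := {0}) fun k hk => ?_
    rw [Finset.notMem_singleton] at hk
    simp [hk]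
  refine summable_of_ratio_test_tendsto_lt_one (l := 0) one_pos (.of_forall fun k => ?_) ?_
  · have := (Gamma_add_nat_pos hν k).ne'
    positivity
  · have key : ∀ k : ℕ, ‖s ^ (k + 1) / (((k + 1).factorial : ℝ) * Real.Gamma (ν + (k + 1 : ℕ) + 1))‖ /
        ‖s ^ k / ((k.factorial : ℝ) * Real.Gamma (ν + k + 1))‖
          = |s| * ((1 / ((k : ℝ) + 1)) * (((k : ℝ) + (ν + 1))⁻¹)) := by
      intro k
      have h0 : (0 : ℝ) ≤ k := k.cast_nonneg
      have h1 := Gamma_add_nat_pos hν k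
      have h2 : 0 < ν + k + 1 := by linarith
      have h3 : (k : ℝ) + (ν + 1) = ν + k + 1 := by ring
      have h4 : (0 : ℝ) < k.factorial := by positivity
      have h5 : (0 : ℝ) < k + 1 := by linarith
      rw [Gamma_add_nat_succ hν, Nat.factorial_succ, h3, ← norm_div, Real.norm_eq_abs,
        ← abs_of_pos (show 0 < 1 / ((k : ℝ) + 1) * (ν + k + 1)⁻¹ by positivity), ← abs_mul]
      congr 1
      push_cast
      field_simp
      ring
    simp_rw [key]
    have a : Tendsto (fun k : ℕ => 1 / ((k : ℝ) + 1)) atTop (𝓝 0) :=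
      tendsto_one_div_add_atTop_nhds_zero_nat
    have b : Tendsto (fun k : ℕ => ((k : ℝ) + (ν + 1))⁻¹) atTop (𝓝 0) :=
      tendsto_inv_atTop_zero.comp (tendsto_atTop_add_const_right _ _ tendsto_natCast_atTop_atTop)
    simpa using (a.mul b).const_mul |s|

theorem besselSeries_succ_term (ν s : ℝ) (k : ℕ) :
    ((k + 1 : ℕ) : ℝ) * s ^ k / (((k + 1).factorial : ℝ) * Real.Gamma (ν + (k + 1 : ℕ) + 1)) =
      s ^ k / ((k.factorial : ℝ) * Real.Gamma (ν + 1 + k + 1)) := by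
  have e : ν + (k + 1 : ℕ) + 1 = ν + 1 + k + 1 := by push_cast; ring
  rw [e, Nat.factorial_succ, Nat.cast_mul, mul_assoc, mul_div_mul_left]
  positivity

theorem hasDerivAt_besselSeries {ν : ℝ} (hν : -1 < ν) (s : ℝ) :
    HasDerivAt (besselSeries ν) (besselSeries (ν + 1) s) s := by
  have hν1 : -1 < ν + 1 := by linarith
  -- At `k = 0` the exponent `k - 1` truncates to `0`, but the factor `k` kills the term. On `|y| <
  -- |s| + 1` the terms are dominated by their values at `|s| + 1`.
  set g' : ℕ → ℝ → ℝ := fun k y =>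
    (k : ℝ) * y ^ (k - 1) / ((k.factorial : ℝ) * Real.Gamma (ν + k + 1)) with hg'
  have hsucc : ∀ k y, g' (k + 1) y = y ^ k / ((k.factorial : ℝ) * Real.Gamma (ν + 1 + k + 1)) :=
    fun k y => besselSeries_succ_term ν y k
  have hsum : ∀ y, Summable fun k => g' k y := fun y => by
    rw [← summable_nat_add_iff 1]
    simp_rw [hsucc]
    exact summable_besselSeries hν1 y
  have hs : besselSeries (ν + 1) s = ∑' k, g' k s := by
    rw [(hsum s).tsum_eq_zero_add]
    simp_rw [hsucc]
    simp [hg', besselSeries]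
  rw [hs]
  refine hasDerivAt_tsum_of_isPreconnected (t := Ioo (-(|s| + 1)) (|s| + 1)) (y₀ := s)
    (hsum (|s| + 1)) isOpen_Ioo isPreconnected_Ioo (fun k y _ => ?_) (fun k y hy => ?_)
    ?_ (summable_besselSeries hν s) ?_
  · simpa [hg'] using (hasDerivAt_pow k y).div_const _
  · have h1 := Gamma_add_nat_pos hν k
    have hy' : |y| ≤ |s| + 1 := abs_le.2 ⟨hy.1.le, hy.2.le⟩
    simp only [hg', norm_div, norm_mul, norm_pow, Real.norm_eq_abs, Nat.abs_cast, abs_of_pos h1]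
    gcongr
  all_goals exact ⟨by linarith [neg_abs_le s], by linarith [le_abs_self s]⟩

/-- Bessel's equation in the variable `s`, namely `s y'' + (ν+1) y' = y`. The coefficients of
`s^{k+1}` agree because `(k+1) + (ν+1)` is the factor relating `Γ(ν+k+3)` to `Γ(ν+k+2)`. -/
theorem besselSeries_recurrence {ν : ℝ} (hν : -1 < ν) (s : ℝ) :
    s * besselSeries (ν + 1 + 1) s + (ν + 1) * besselSeries (ν + 1) s = besselSeries ν s := by
  have h1 := summable_besselSeries (ν := ν + 1) (by linarith) s
  have h2 := summable_besselSeries (ν := ν + 1 + 1) (by linarith) s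
  have h0 := summable_besselSeries hν s
  have hG := Real.Gamma_add_one (s := ν + 1) (by linarith)
  have hG1 : Real.Gamma (ν + 1) ≠ 0 := (Real.Gamma_pos_of_pos (by linarith)).ne'
  have hν1 : ν + 1 ≠ 0 := by linarith
  unfold besselSeries
  rw [h1.tsum_eq_zero_add, h0.tsum_eq_zero_add, mul_add, add_left_comm, ← tsum_mul_left,
    ← tsum_mul_left, ← ((h2.mul_left s).tsum_add (((summable_nat_add_iff 1).2 h1).mul_left _))]
  congr 1
  · simp [hG]
    field_simp
  · refine tsum_congr fun k => ?_
    have hk : (0 : ℝ) ≤ k := k.cast_nonneg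
    have hp := Gamma_add_nat_pos (ν := ν + 1) (by linarith) k
    have e1 : Real.Gamma (ν + 1 + 1 + k + 1) = (ν + 1 + k + 1) * Real.Gamma (ν + 1 + k + 1) := by
      rw [← Real.Gamma_add_one (by linarith)]; ring_nf
    have e2 : Real.Gamma (ν + 1 + (k + 1 : ℕ) + 1) =
        (ν + 1 + k + 1) * Real.Gamma (ν + 1 + k + 1) := Gamma_add_nat_succ (by linarith) k
    have e3 : Real.Gamma (ν + (k + 1 : ℕ) + 1) = Real.Gamma (ν + 1 + k + 1) := by
      push_cast; ring_nf
    have hq : ν + 1 + k + 1 ≠ 0 := by linarith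
    rw [e1, e2, e3, Nat.factorial_succ]
    push_cast
    field_simp
    ring

theorem contDiff_besselSeries {ν : ℝ} (hν : -1 < ν) : ContDiff ℝ ∞ (besselSeries ν) := by
  rw [contDiff_infty]
  intro m
  induction m generalizing ν with
  | zero =>
    exact contDiff_zero.2 (continuous_iff_continuousAt.2 fun s =>
      (hasDerivAt_besselSeries hν s).continuousAt)
  | succ m ih =>
    have hd : deriv (besselSeries ν) = besselSeries (ν + 1) :=
      funext fun s => (hasDerivAt_besselSeries hν s).deriv
    have := ih (ν := ν + 1) (by linarith)
    push_cast
    refine contDiff_succ_iff_deriv.2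
      ⟨fun s => (hasDerivAt_besselSeries hν s).differentiableAt, by simp, hd ▸ this⟩

theorem contDiff_besselEntire {ν : ℝ} (hν : -1 < ν) : ContDiff ℝ ∞ (besselEntire ν) :=
  (contDiff_besselSeries hν).comp (contDiff_const.mul (contDiff_id.pow 2))

theorem continuous_besselEntire {ν : ℝ} (hν : -1 < ν) : Continuous (besselEntire ν) :=
  (contDiff_besselEntire hν).continuous

theorem hasDerivAt_besselEntire {ν : ℝ} (hν : -1 < ν) (z : ℝ) :
    HasDerivAt (besselEntire ν) (-(z / 2) * besselEntire (ν + 1) z) z := by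
  have h : HasDerivAt (fun z : ℝ => -(1 / 4) * z ^ 2) (-(1 / 4) * (2 * z)) z := by
    simpa using (hasDerivAt_pow 2 z).const_mul (-(1 / 4) : ℝ)
  refine ((hasDerivAt_besselSeries hν _).comp z h).congr_deriv ?_
  simp only [besselEntire]
  ring

/-- By the recurrence, the pair `F_ν, F_{ν+1}` satisfies a closed first order system, so `F_{ν+2}`
never appears below. -/
theorem hasDerivAt_besselEntire_succ {ν : ℝ} (hν : -1 < ν) {z : ℝ} (hz : z ≠ 0) :
    HasDerivAt (besselEntire (ν + 1))
      (2 / z * (besselEntire ν z - (ν + 1) * besselEntire (ν + 1) z)) z := by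
  refine (hasDerivAt_besselEntire (by linarith) z).congr_deriv ?_
  have := besselSeries_recurrence hν (-(1 / 4) * z ^ 2)
  simp only [besselEntire]
  rw [← this]
  field_simp
  ring

theorem besselEntire_zero_pos {ν : ℝ} (hν : -1 < ν) : 0 < besselEntire ν 0 := by
  have : besselEntire ν 0 = (Real.Gamma (ν + 1))⁻¹ := by
    simp only [besselEntire, besselSeries]
    rw [tsum_eq_single 0 fun k hk => by simp [hk]]
    simp
  rw [this]
  exact inv_pos.2 (Real.Gamma_pos_of_pos (by linarith))

end FourierBessel

/-! ### Positive zeros: simplicity, existence, alternation of signs -/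

namespace FourierBessel

theorem pos_of_forall_ne_zero {f : ℝ → ℝ} {s : Set ℝ} (hs : IsPreconnected s)
    (hf : ContinuousOn f s) (h0 : ∀ z ∈ s, f z ≠ 0) {x y : ℝ} (hx : x ∈ s) (hy : y ∈ s)
    (hfx : 0 < f x) : 0 < f y := by
  by_contra! hfy
  obtain ⟨z, hz, hz0⟩ := hs.intermediate_value hy hx hf ⟨hfy, hfx.le⟩
  exact h0 z hz hz0

/-- The positive zeros of `besselEntire ν` are simple. -/
theorem besselEntire_succ_ne_zero {ν : ℝ} (hν : -1 < ν) {l : ℝ} (hl : 0 < l)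
    (h : besselEntire ν l = 0) : besselEntire (ν + 1) l ≠ 0 := by
  intro h'
  -- The energy `F_ν^2 + (F_ν')^2` has derivative `-2(2ν+1)(F_ν')^2/z`. The weight `z^{2m}` with `m
  -- ≥ 2ν+1` makes it nondecreasing for every `ν`; a double zero at `l` would then force `F_ν = 0`
  -- on `(0,l)`, against `F_ν(0) > 0`.
  obtain ⟨m, hm⟩ := exists_nat_ge (2 * ν + 1)
  set H : ℝ → ℝ := fun z =>
    z ^ (2 * m) * (besselEntire ν z ^ 2 + (z / 2 * besselEntire (ν + 1) z) ^ 2) with hH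
  have hder : ∀ z, 0 < z → HasDerivAt H (z ^ (2 * m) * (2 / z) *
      (m * besselEntire ν z ^ 2 +
        (m - (2 * ν + 1)) * (z / 2 * besselEntire (ν + 1) z) ^ 2)) z := by
    intro z hz
    have h1 := hasDerivAt_besselEntire hν z
    have h2 := hasDerivAt_besselEntire_succ hν hz.ne'
    have h3 : HasDerivAt (fun z : ℝ => z ^ (2 * m)) (2 * m * z ^ (2 * m) / z) z := by
      refine (hasDerivAt_pow (2 * m) z).congr_deriv ?_
      rcases Nat.eq_zero_or_pos m with rfl | hmpos
      · simp
      · obtain ⟨j, hj⟩ : ∃ j, 2 * m = j + 1 := ⟨2 * m - 1, by omega⟩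
        have hj' : (2 * m : ℝ) = j + 1 := by exact_mod_cast hj
        rw [hj, hj']
        simp only [Nat.add_sub_cancel, pow_succ]
        push_cast
        field_simp
    refine (h3.mul ((h1.pow 2).add ((((hasDerivAt_id z).div_const 2).mul h2).pow 2))).congr_deriv ?_
    simp
    field_simp
    ring
  have hmono : MonotoneOn H (Icc 0 l) := by
    refine monotoneOn_of_deriv_nonneg (convex_Icc 0 l) ?_ ?_ ?_
    · have := continuous_besselEntire hν
      have := continuous_besselEntire (ν := ν + 1) (by linarith)
      exact Continuous.continuousOn (by fun_prop)
    · rw [interior_Icc]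
      exact fun z hz => (hder z hz.1).differentiableAt.differentiableWithinAt
    · rw [interior_Icc]
      intro z hz
      have := hz.1
      have : 0 ≤ (m : ℝ) - (2 * ν + 1) := by linarith
      rw [(hder z hz.1).deriv]
      positivity
  have hzero : ∀ z ∈ Ioo 0 l, besselEntire ν z = 0 := by
    intro z hz
    have h1 : H z ≤ H l := hmono ⟨hz.1.le, hz.2.le⟩ ⟨hl.le, le_rfl⟩ hz.2.le
    have h2 : H l = 0 := by simp [hH, h, h']
    have h3 : 0 < z ^ (2 * m) := pow_pos hz.1 _
    have h4 := sq_nonneg (besselEntire ν z)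
    have h5 := sq_nonneg (z / 2 * besselEntire (ν + 1) z)
    rw [h2] at h1
    have h6 : besselEntire ν z ^ 2 + (z / 2 * besselEntire (ν + 1) z) ^ 2 ≤ 0 :=
      nonpos_of_mul_nonpos_right h1 h3
    exact pow_eq_zero_iff two_ne_zero |>.1 (by linarith)
  have hev : ∀ᶠ z in 𝓝[>] (0 : ℝ), 0 < besselEntire ν z :=
    nhdsWithin_le_nhds
      ((continuous_besselEntire hν).continuousAt.eventually (lt_mem_nhds (besselEntire_zero_pos hν)))
  obtain ⟨z, hz, hz'⟩ := (hev.and (Ioo_mem_nhdsGT hl)).exists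
  exact hz.ne' (hzero z hz')

/-- Sturm comparison of `√z J_ν(z)` with `sin ((z - b) / 2)`. -/
theorem exists_besselEntire_nonpos {ν : ℝ} (hν : -1 < ν) {b c : ℝ} (hb : 2 * |ν| + 1 ≤ b) :
    ∃ z ∈ Icc b (b + 2 * Real.pi), c * besselEntire ν z ≤ 0 := by
  by_contra! hpos
  have hπ := Real.pi_pos
  have hb0 : 0 < b := by have := abs_nonneg ν; linarith
  set p : ℝ → ℝ := fun z => z ^ (ν - 1 / 2)
  set F := besselEntire ν
  set G := besselEntire (ν + 1)
  -- This is `c (u v' - u' v)` with `u = z^{ν+1/2} F_ν`, a solution of `u'' + (1 - (ν^2 - 1/4)/z^2)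
  -- u = 0`, and `v = sin((z-b)/2)`, for which `v'' = -v/4`. If `c u > 0` throughout, `W` is
  -- nondecreasing on a half period of the sine (length `2π`), yet it is positive at the left end
  -- and negative at the right.
  set W : ℝ → ℝ := fun z => p z * ((c * (z * F z)) * (Real.cos ((z - b) / 2) / 2) -
    (c * ((ν + 1 / 2) * F z - z ^ 2 / 2 * G z)) * Real.sin ((z - b) / 2)) with hW
  have hder : ∀ z, 0 < z → HasDerivAt W (p z * (z * (c * F z)) * Real.sin ((z - b) / 2) *
      (1 - (ν ^ 2 - 1 / 4) / z ^ 2 - 1 / 4)) z := by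
    intro z hz
    have h1 : HasDerivAt F _ z := hasDerivAt_besselEntire hν z
    have h2 : HasDerivAt G _ z := hasDerivAt_besselEntire_succ hν hz.ne'
    have h3 : HasDerivAt p ((ν - 1 / 2) * p z / z) z := by
      refine (Real.hasDerivAt_rpow_const (Or.inl hz.ne')).congr_deriv ?_
      rw [Real.rpow_sub_one hz.ne']
      ring
    have h4 : HasDerivAt (fun z : ℝ => (z - b) / 2) (1 / 2) z :=
      ((hasDerivAt_id z).sub_const b).div_const 2
    have h5 := h4.cos.div_const 2
    have h6 := h4.sin
    have h7 : HasDerivAt (fun z : ℝ => z ^ 2 / 2) z z := by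
      simpa using (hasDerivAt_pow 2 z).div_const 2
    refine (h3.mul (((((hasDerivAt_id z).mul h1).const_mul c).mul h5).sub
      ((((h1.const_mul (ν + 1 / 2)).sub (h7.mul h2)).const_mul c).mul h6))).congr_deriv ?_
    simp only [Pi.mul_apply, Pi.sub_apply, id]
    field_simp
    ring
  have hmem : ∀ z ∈ Icc b (b + 2 * Real.pi), 0 < z := fun z hz => hb0.trans_le hz.1
  have hmono : MonotoneOn W (Icc b (b + 2 * Real.pi)) := by
    refine monotoneOn_of_deriv_nonneg (convex_Icc _ _)
      (fun z hz => (hder z (hmem z hz)).continuousAt.continuousWithinAt) ?_ ?_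
    · rw [interior_Icc]
      exact fun z hz => (hder z (hmem z (Ioo_subset_Icc_self hz))).differentiableAt.differentiableWithinAt
    · rw [interior_Icc]
      intro z hz
      have hz' := Ioo_subset_Icc_self hz
      have hz0 := hmem z hz'
      rw [(hder z hz0).deriv]
      have hp : 0 < p z := Real.rpow_pos_of_pos hz0 _
      have hF := hpos z hz'
      have hs : 0 ≤ Real.sin ((z - b) / 2) :=
        Real.sin_nonneg_of_nonneg_of_le_pi (by linarith [hz.1]) (by linarith [hz.2])
      -- Here `z ≥ 2|ν|` gives `ν^2/z^2 ≤ 1/4`, well below the required `3/4`.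
      have hq : 0 ≤ 1 - (ν ^ 2 - 1 / 4) / z ^ 2 - 1 / 4 := by
        have : (ν ^ 2 - 1 / 4) / z ^ 2 ≤ 3 / 4 := by
          rw [div_le_iff₀ (by positivity)]
          have h1 : 2 * |ν| ≤ z := by linarith [hz'.1]
          have h2 : (2 * |ν|) ^ 2 ≤ z ^ 2 := by gcongr
          rw [mul_pow, sq_abs] at h2
          nlinarith [sq_nonneg ν]
        linarith
      positivity
  have hle := hmono (left_mem_Icc.2 (by linarith)) (right_mem_Icc.2 (by linarith))
    (by linarith : b ≤ b + 2 * Real.pi)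
  have hWb : 0 < W b := by
    have h1 := hpos b (left_mem_Icc.2 (by linarith))
    have h2 : 0 < p b := Real.rpow_pos_of_pos hb0 _
    have : W b = p b * (b * (c * F b)) / 2 := by simp [hW]; ring
    rw [this]
    positivity
  have hWe : W (b + 2 * Real.pi) < 0 := by
    have h1 := hpos (b + 2 * Real.pi) (right_mem_Icc.2 (by linarith))
    have h2 : 0 < p (b + 2 * Real.pi) := Real.rpow_pos_of_pos (by linarith) _
    have : W (b + 2 * Real.pi) =
        -(p (b + 2 * Real.pi) * ((b + 2 * Real.pi) * (c * F (b + 2 * Real.pi))) / 2) := by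
      simp [hW]; ring
    rw [this]
    exact neg_neg_of_pos (by positivity)
  linarith

theorem exists_besselEntire_eq_zero_gt {ν : ℝ} (hν : -1 < ν) (a : ℝ) :
    ∃ x, a < x ∧ besselEntire ν x = 0 := by
  by_contra! h
  set b := max (a + 1) (2 * |ν| + 1)
  have hb : a < b := (lt_add_one a).trans_le (le_max_left _ _)
  -- Taking `c = F_ν(b)` makes `c F_ν` positive at `b` whatever the sign of `F_ν` there.
  obtain ⟨z, hz, hz0⟩ := exists_besselEntire_nonpos hν (c := besselEntire ν b)
    (le_max_right (a + 1) (2 * |ν| + 1))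
  have hcont := (continuous_besselEntire hν).const_mul (besselEntire ν b)
  have := pos_of_forall_ne_zero (s := Ioi a) (x := b) (y := z) isPreconnected_Ioi hcont.continuousOn
    (fun x hx => mul_ne_zero (h b hb) (h x hx)) hb (hb.trans_le hz.1) (mul_self_pos.2 (h b hb))
  exact absurd hz0 this.not_ge

theorem besselJ_eq_zero_iff (ν : ℝ) {z : ℝ} (hz : 0 < z) :
    besselJ ν z = 0 ↔ besselEntire ν z = 0 := by
  rw [besselJ_eq, mul_eq_zero, or_iff_right (Real.rpow_pos_of_pos (half_pos hz) _).ne']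

/-- Zeros cannot accumulate at `a` from the right by hypothesis, so the strict bound `a < x` may be
replaced by a closed one; the set of zeros is then closed and nonempty, and its infimum is attained.
-/
theorem sInf_besselJ_zeros {ν : ℝ} (hν : -1 < ν) {a : ℝ} (ha : 0 ≤ a)
    (h : ∀ᶠ x in 𝓝[>] a, besselEntire ν x ≠ 0) {s : ℝ}
    (hs : s = sInf {x : ℝ | a < x ∧ besselJ ν x = 0}) :
    a < s ∧ besselEntire ν s = 0 ∧ ∀ x ∈ Ioo a s, besselEntire ν x ≠ 0 := by
  obtain ⟨c, hc, hac⟩ := mem_nhdsGT_iff_exists_Ioo_subset.1 h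
  have hset : {x : ℝ | a < x ∧ besselJ ν x = 0} = Ici c ∩ besselEntire ν ⁻¹' {0} := by
    ext x
    constructor
    · rintro ⟨hx, h0⟩
      have h0 := (besselJ_eq_zero_iff ν (ha.trans_lt hx)).1 h0
      exact ⟨not_lt.1 fun hxc => hac ⟨hx, hxc⟩ h0, h0⟩
    · rintro ⟨hx, h0⟩
      have hx' : a < x := lt_of_lt_of_le hc hx
      exact ⟨hx', (besselJ_eq_zero_iff ν (ha.trans_lt hx')).2 h0⟩
  have hbdd : BddBelow {x : ℝ | a < x ∧ besselJ ν x = 0} := ⟨a, fun x hx => hx.1.le⟩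
  have hmem : s ∈ {x : ℝ | a < x ∧ besselJ ν x = 0} := by
    rw [hs]
    refine IsClosed.csInf_mem ?_ ?_ hbdd
    · rw [hset]
      exact isClosed_Ici.inter (isClosed_singleton.preimage (continuous_besselEntire hν))
    · obtain ⟨x, hx, hx0⟩ := exists_besselEntire_eq_zero_gt hν a
      exact ⟨x, hx, (besselJ_eq_zero_iff ν (ha.trans_lt hx)).2 hx0⟩
  refine ⟨hmem.1, (besselJ_eq_zero_iff ν (ha.trans_lt hmem.1)).1 hmem.2, fun x hx h0 => ?_⟩
  refine absurd (csInf_le hbdd ⟨hx.1, (besselJ_eq_zero_iff ν (ha.trans_lt hx.1)).2 h0⟩) ?_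
  rw [← hs]
  exact hx.2.not_ge

/-- At the next zero `b` the signed function descends to `0`, so its slope `-(b/2) (-1)^k
F_{ν+1}(b)` is nonpositive; simplicity of the zero makes the inequality strict. -/
theorem besselZero_succ_aux {ν : ℝ} (hν : -1 < ν) {k : ℕ} (h0 : 0 ≤ besselZero ν k)
    (h : ∀ᶠ x in 𝓝[>] besselZero ν k, 0 < (-1) ^ k * besselEntire ν x) :
    besselZero ν k < besselZero ν (k + 1) ∧ besselEntire ν (besselZero ν (k + 1)) = 0 ∧
      (∀ x ∈ Ioo (besselZero ν k) (besselZero ν (k + 1)), 0 < (-1) ^ k * besselEntire ν x) ∧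
      0 < (-1) ^ k * besselEntire (ν + 1) (besselZero ν (k + 1)) := by
  obtain ⟨h1, h2, h3⟩ := sInf_besselJ_zeros (s := besselZero ν (k + 1)) hν h0
    (h.mono fun x hx h => by simp [h] at hx) rfl
  set b := besselZero ν (k + 1)
  have hb : 0 < b := h0.trans_lt h1
  have hsign : ∀ x ∈ Ioo (besselZero ν k) b, 0 < (-1) ^ k * besselEntire ν x := by
    intro x hx
    obtain ⟨y, hy, hy'⟩ := (h.and (Ioo_mem_nhdsGT h1)).exists
    exact pos_of_forall_ne_zero isPreconnected_Ioo
      ((continuous_besselEntire hν).const_mul ((-1) ^ k)).continuousOn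
      (fun z hz => mul_ne_zero (by simp) (h3 z hz)) hy' hx hy
  refine ⟨h1, h2, hsign, ?_⟩
  have hd := (hasDerivAt_besselEntire hν b).const_mul ((-1) ^ k)
  have hle : (-1) ^ k * (-(b / 2) * besselEntire (ν + 1) b) ≤ 0 := by
    refine le_of_tendsto (hd.tendsto_slope.mono_left
      (nhdsWithin_mono b (s := Iio b) fun x hx => ne_of_lt hx)) ?_
    filter_upwards [Ioo_mem_nhdsLT h1] with x hx
    rw [slope_def_field, h2, mul_zero, sub_zero]
    exact div_nonpos_of_nonneg_of_nonpos (hsign x hx).le (by linarith [hx.2])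
  refine lt_of_le_of_ne ?_ (mul_ne_zero (by simp) (besselEntire_succ_ne_zero hν hb h2)).symm
  have : 0 ≤ (b / 2) * ((-1) ^ k * besselEntire (ν + 1) b) := by linarith
  exact nonneg_of_mul_nonneg_right this (half_pos hb)

/-- The nonzero slope at each zero flips the sign just to its right, which carries the induction; it
starts from `F_ν(0) > 0`. -/
theorem besselZero_nonneg_and_sign {ν : ℝ} (hν : -1 < ν) (k : ℕ) :
    0 ≤ besselZero ν k ∧ ∀ᶠ x in 𝓝[>] besselZero ν k, 0 < (-1) ^ k * besselEntire ν x := by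
  induction k with
  | zero =>
    have h := (continuous_besselEntire hν).continuousAt.eventually
      (lt_mem_nhds (besselEntire_zero_pos hν))
    exact ⟨le_rfl, by simpa [besselZero] using h.filter_mono nhdsWithin_le_nhds⟩
  | succ k ih =>
    obtain ⟨h1, h2, -, h4⟩ := besselZero_succ_aux hν ih.1 ih.2
    set b := besselZero ν (k + 1)
    have hb : 0 < b := ih.1.trans_lt h1
    refine ⟨hb.le, ?_⟩
    have hd := (hasDerivAt_besselEntire hν b).const_mul ((-1) ^ (k + 1))
    have hpos : 0 < (-1) ^ (k + 1) * (-(b / 2) * besselEntire (ν + 1) b) := by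
      have : (-1) ^ (k + 1) * (-(b / 2) * besselEntire (ν + 1) b) =
        (b / 2) * ((-1) ^ k * besselEntire (ν + 1) b) := by ring
      rw [this]
      positivity
    have hev := (hd.tendsto_slope.mono_left
      (nhdsWithin_mono b (s := Ioi b) fun x hx => ne_of_gt hx)).eventually (lt_mem_nhds hpos)
    filter_upwards [hev, self_mem_nhdsWithin] with x hx hbx
    rw [slope_def_field, h2, mul_zero, sub_zero] at hx
    exact (div_pos_iff_of_pos_right (sub_pos.2 hbx)).1 hx

/-- The zeros of `J_ν` form a strictly increasing sequence of simple zeros, and `J_ν` has the sign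
`(-1) ^ k` between the `k`-th and the `(k + 1)`-st. -/
theorem besselZero_succ_spec {ν : ℝ} (hν : -1 < ν) (k : ℕ) :
    besselZero ν k < besselZero ν (k + 1) ∧ besselEntire ν (besselZero ν (k + 1)) = 0 ∧
      (∀ x ∈ Ioo (besselZero ν k) (besselZero ν (k + 1)), 0 < (-1) ^ k * besselEntire ν x) ∧
      0 < (-1) ^ k * besselEntire (ν + 1) (besselZero ν (k + 1)) :=
  besselZero_succ_aux hν (besselZero_nonneg_and_sign hν k).1 (besselZero_nonneg_and_sign hν k).2

end FourierBessel

/-! ### Fourier–Bessel functions in terms of the entire factor -/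

namespace FourierBessel

theorem besselZero_strictMono {ν : ℝ} (hν : -1 < ν) : StrictMono (besselZero ν) :=
  strictMono_nat_of_lt_succ fun k => (besselZero_succ_spec hν k).1

theorem besselZero_succ_pos {ν : ℝ} (hν : -1 < ν) (k : ℕ) : 0 < besselZero ν (k + 1) :=
  (besselZero_nonneg_and_sign hν k).1.trans_lt (besselZero_succ_spec hν k).1

theorem besselEntire_besselZero_one_mul_pos {ν : ℝ} (hν : -1 < ν) {x : ℝ} (hx : x ∈ Ioo 0 1) :
    0 < besselEntire ν (besselZero ν 1 * x) := by
  have hl : 0 < besselZero ν 1 := besselZero_succ_pos hν 0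
  simpa using (besselZero_succ_spec hν 0).2.2.1 (besselZero ν 1 * x)
    ⟨mul_pos hl hx.1, mul_lt_of_lt_one_right hl hx.2⟩

theorem besselEntire_succ_besselZero_one_pos {ν : ℝ} (hν : -1 < ν) :
    0 < besselEntire (ν + 1) (besselZero ν 1) := by
  simpa using (besselZero_succ_spec hν 0).2.2.2

theorem exists_phi_eq {ν : ℝ} (hν : -1 < ν) (k : ℕ) :
    ∃ A : ℝ, 0 < A ∧ ∀ x, 0 < x →
      phi ν (k + 1) x = A * besselEntire ν (besselZero ν (k + 1) * x) := by
  have hl := besselZero_succ_pos hν k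
  have hG : besselEntire (ν + 1) (besselZero ν (k + 1)) ≠ 0 :=
    right_ne_zero_of_mul (besselZero_succ_spec hν k).2.2.2.ne'
  have hJ : besselJ (ν + 1) (besselZero ν (k + 1)) ≠ 0 :=
    fun h => hG ((besselJ_eq_zero_iff (ν + 1) hl).1 h)
  refine ⟨√2 / |besselJ (ν + 1) (besselZero ν (k + 1))| * (besselZero ν (k + 1) / 2) ^ ν, ?_,
    fun x hx => ?_⟩
  · have := Real.rpow_pos_of_pos (half_pos hl) ν
    positivity
  · have h1 : (besselZero ν (k + 1) * x / 2) ^ ν = (besselZero ν (k + 1) / 2) ^ ν * x ^ ν := by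
      rw [← Real.mul_rpow (half_pos hl).le hx.le]
      ring_nf
    have h2 : x ^ (-ν) * x ^ ν = 1 := by
      rw [← Real.rpow_add hx, neg_add_cancel, Real.rpow_zero]
    rw [phi, besselJ_eq ν, h1]
    linear_combination (√2 / |besselJ (ν + 1) (besselZero ν (k + 1))| *
      (besselZero ν (k + 1) / 2) ^ ν * besselEntire ν (besselZero ν (k + 1) * x)) * h2

theorem R_one_eq {ν : ℝ} (hν : -1 < ν) {x : ℝ} (hx : x ∈ Ioo 0 1) :
    R ν 1 x = besselZero ν 1 ^ 2 * x / 2 * besselEntire (ν + 1) (besselZero ν 1 * x) /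
      besselEntire ν (besselZero ν 1 * x) := by
  have hl : 0 < besselZero ν 1 * x := mul_pos (besselZero_succ_pos hν 0) hx.1
  have hF := besselEntire_besselZero_one_mul_pos hν hx
  have hp := Real.rpow_pos_of_pos (half_pos hl) ν
  rw [R, besselJ_eq, besselJ_eq, Real.rpow_add_one (half_pos hl).ne']
  field_simp

theorem hasDerivAt_besselEntire_const_mul {ν : ℝ} (hν : -1 < ν) (a x : ℝ) :
    HasDerivAt (fun x => besselEntire ν (a * x))
      (-(a ^ 2 * x / 2) * besselEntire (ν + 1) (a * x)) x := by
  refine ((hasDerivAt_besselEntire hν (a * x)).comp x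
    ((hasDerivAt_id x).const_mul a)).congr_deriv ?_
  simp
  ring

/-! ### The Wronskian and its order of vanishing at both endpoints -/

/-- `2 / x` times the Wronskian of `F_ν(a x)` and `F_ν(b x)`, where `F_ν = besselEntire ν`. -/
noncomputable def wronskian (ν a b x : ℝ) : ℝ :=
  a ^ 2 * besselEntire (ν + 1) (a * x) * besselEntire ν (b * x) -
    b ^ 2 * besselEntire ν (a * x) * besselEntire (ν + 1) (b * x)

theorem contDiff_wronskian {ν : ℝ} (hν : -1 < ν) (a b : ℝ) : ContDiff ℝ ∞ (wronskian ν a b) := by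
  have h0 := contDiff_besselEntire hν
  have h1 := contDiff_besselEntire (ν := ν + 1) (by linarith)
  have ha : ContDiff ℝ ∞ fun x : ℝ => a * x := contDiff_const.mul contDiff_id
  have hb : ContDiff ℝ ∞ fun x : ℝ => b * x := contDiff_const.mul contDiff_id
  exact ((contDiff_const.mul (h1.comp ha)).mul (h0.comp hb)).sub
    ((contDiff_const.mul (h0.comp ha)).mul (h1.comp hb))

/-- Lagrange's identity: `y = F_ν(a x)` solves `(x^{2ν+1} y')' = -a^2 x^{2ν+1} y`, and likewise for
`b`, so the weighted Wronskian has derivative proportional to `a^2 - b^2`. -/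
theorem hasDerivAt_rpow_mul_wronskian {ν : ℝ} (hν : -1 < ν) {a b x : ℝ} (ha : a ≠ 0) (hb : b ≠ 0)
    (hx : 0 < x) :
    HasDerivAt (fun x => x ^ (2 * ν + 2) * wronskian ν a b x)
      (2 * x ^ (2 * ν + 1) * (a ^ 2 - b ^ 2) * besselEntire ν (a * x) * besselEntire ν (b * x))
      x := by
  have h0 : HasDerivAt (fun x : ℝ => x ^ (2 * ν + 2)) ((2 * ν + 2) * x ^ (2 * ν + 1)) x := by
    refine (Real.hasDerivAt_rpow_const (Or.inl hx.ne')).congr_deriv ?_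
    ring_nf
  have hsucc : ∀ c : ℝ, c ≠ 0 → HasDerivAt (fun x => besselEntire (ν + 1) (c * x))
      (2 / x * (besselEntire ν (c * x) - (ν + 1) * besselEntire (ν + 1) (c * x))) x := by
    intro c hc
    refine ((hasDerivAt_besselEntire_succ hν (mul_ne_zero hc hx.ne')).comp x
      ((hasDerivAt_id x).const_mul c)).congr_deriv ?_
    simp
    field_simp
  have hFa := hasDerivAt_besselEntire_const_mul hν a x
  have hFb := hasDerivAt_besselEntire_const_mul hν b x
  have hx2 : x ^ (2 * ν + 2) = x ^ (2 * ν + 1) * x := by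
    rw [← Real.rpow_add_one hx.ne']
    ring_nf
  refine (h0.mul ((((hsucc a ha).const_mul (a ^ 2)).mul hFb).sub
    ((hFa.const_mul (b ^ 2)).mul (hsucc b hb)))).congr_deriv ?_
  simp only [Pi.mul_apply, Pi.sub_apply]
  rw [hx2]
  field_simp
  ring

theorem tendsto_besselEntire_div_one_sub {ν : ℝ} (hν : -1 < ν) {a : ℝ}
    (h : besselEntire ν a = 0) :
    Tendsto (fun x => besselEntire ν (a * x) / (1 - x)) (𝓝[<] 1)
      (𝓝 (a ^ 2 / 2 * besselEntire (ν + 1) a)) := by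
  have hd := (hasDerivAt_besselEntire_const_mul hν a 1).neg
  have := hd.tendsto_slope.mono_left (nhdsWithin_mono 1 (s := Iio 1) fun x hx => ne_of_lt hx)
  rw [mul_one] at this
  convert this using 2 with x
  · rw [slope_def_field, Pi.neg_apply, Pi.neg_apply, mul_one, h, neg_zero, sub_zero,
      ← neg_sub x 1, div_neg, neg_div]
  · rw [mul_one]
    ring

/-- L'Hôpital applied to `x^{2ν+2} W / (1-x)^3`: the quotient of derivatives splits into two factors
`F_ν(· x)/(1-x)`, each with a limit. The weight tends to `1` and is divided out at the end. -/
theorem tendsto_wronskian_div_one_sub_pow {ν : ℝ} (hν : -1 < ν) {a b : ℝ} (ha : a ≠ 0) (hb : b ≠ 0)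
    (hFa : besselEntire ν a = 0) (hFb : besselEntire ν b = 0) :
    Tendsto (fun x => wronskian ν a b x / (1 - x) ^ 3) (𝓝[<] 1)
      (𝓝 (2 / 3 * (b ^ 2 - a ^ 2) * (a ^ 2 / 2 * besselEntire (ν + 1) a) *
        (b ^ 2 / 2 * besselEntire (ν + 1) b))) := by
  have hIoo : Ioo (0 : ℝ) 1 ∈ 𝓝[<] (1 : ℝ) := Ioo_mem_nhdsLT one_pos
  have hpow : ∀ r : ℝ, Tendsto (fun x : ℝ => x ^ r) (𝓝[<] 1) (𝓝 1) := fun r => by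
    have := (Real.continuousAt_rpow_const 1 r (Or.inl one_ne_zero)).tendsto
    rw [Real.one_rpow] at this
    exact this.mono_left nhdsWithin_le_nhds
  have hlim : Tendsto (fun x => (x ^ (2 * ν + 2) * wronskian ν a b x) / (1 - x) ^ 3) (𝓝[<] 1)
      (𝓝 (2 / 3 * (b ^ 2 - a ^ 2) * (a ^ 2 / 2 * besselEntire (ν + 1) a) *
        (b ^ 2 / 2 * besselEntire (ν + 1) b))) := by
    refine HasDerivAt.lhopital_zero_nhdsLT (g' := fun x => -(3 * (1 - x) ^ 2)) (f' := fun x =>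
      2 * x ^ (2 * ν + 1) * (a ^ 2 - b ^ 2) * besselEntire ν (a * x) * besselEntire ν (b * x))
      ?_ ?_ ?_ ?_ ?_ ?_
    · filter_upwards [hIoo] with x hx using hasDerivAt_rpow_mul_wronskian hν ha hb hx.1
    · refine .of_forall fun x => ((((hasDerivAt_id x).const_sub 1).pow 3)).congr_deriv ?_
      simp
    · filter_upwards [hIoo] with x hx
      have := sub_pos.2 hx.2
      exact neg_ne_zero.2 (by positivity)
    · have h1 := ((contDiff_wronskian hν a b).continuous.tendsto 1).mono_left
        (nhdsWithin_le_nhds (s := Iio 1))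
      have h2 : wronskian ν a b 1 = 0 := by simp [wronskian, hFa, hFb]
      simpa [h2] using (hpow (2 * ν + 2)).mul h1
    · have : Continuous fun x : ℝ => (1 - x) ^ 3 := by fun_prop
      simpa using (this.tendsto 1).mono_left (nhdsWithin_le_nhds (s := Iio 1))
    · have h1 := (((hpow (2 * ν + 1)).const_mul (2 / 3 * (b ^ 2 - a ^ 2))).mul
        (tendsto_besselEntire_div_one_sub hν hFa)).mul (tendsto_besselEntire_div_one_sub hν hFb)
      rw [mul_one] at h1
      refine h1.congr' ?_
      filter_upwards [hIoo] with x hx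
      have := (sub_pos.2 hx.2).ne'
      field_simp
      ring
  have h2 := hlim.div (hpow (2 * ν + 2)) one_ne_zero
  rw [div_one] at h2
  refine h2.congr' ?_
  filter_upwards [hIoo] with x hx
  rw [Pi.div_apply, mul_div_assoc, mul_div_cancel_left₀ _ (Real.rpow_pos_of_pos hx.1 _).ne']

theorem tendsto_wronskian_zero {ν : ℝ} (hν : -1 < ν) (a b : ℝ) :
    Tendsto (wronskian ν a b) (𝓝[>] 0)
      (𝓝 ((a ^ 2 - b ^ 2) * (besselEntire (ν + 1) 0 * besselEntire ν 0))) := by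
  have h := ((contDiff_wronskian hν a b).continuous.tendsto 0).mono_left
    (nhdsWithin_le_nhds (s := Ioi 0))
  convert h using 2
  simp only [wronskian, mul_zero]
  ring

/-! ### From limits of quotients to two-sided comparison -/

/-- The sign is carried by `σ`, which agrees in sign with `c`. Eventually `f/h` lies between `c/2`
and `2c`; for negative `c` these bounds exchange roles. -/
theorem simeqAlong_of_tendsto_div {l : Filter ℝ} {f h : ℝ → ℝ} {σ c : ℝ}
    (hh : ∀ᶠ x in l, 0 < h x) (hlim : Tendsto (fun x => f x / h x) l (𝓝 c)) (hσ : 0 < σ * c) :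
    SimeqAlong l f (fun x => σ * h x) := by
  rcases pos_and_pos_or_neg_and_neg_of_mul_pos hσ with ⟨h1, h2⟩ | ⟨h1, h2⟩
  · refine ⟨⟨2 * c / σ, by positivity, ?_⟩, ⟨2 * σ / c, by positivity, ?_⟩⟩
    · filter_upwards [hh, hlim.eventually (gt_mem_nhds (show c < 2 * c by linarith))] with x hx hf
      rw [div_lt_iff₀ hx] at hf
      rw [← mul_assoc, div_mul_cancel₀ _ h1.ne']
      exact hf.le
    · filter_upwards [hh, hlim.eventually (lt_mem_nhds (show c / 2 < c by linarith))] with x hx hf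
      rw [lt_div_iff₀ hx] at hf
      calc σ * h x = 2 * σ / c * (c / 2 * h x) := by field_simp
        _ ≤ _ := by gcongr
  · have h1' := h1.ne
    have h2' := h2.ne
    refine ⟨⟨c / (2 * σ), div_pos_of_neg_of_neg h2 (by linarith), ?_⟩,
      ⟨σ / (2 * c), div_pos_of_neg_of_neg h1 (by linarith), ?_⟩⟩
    · filter_upwards [hh, hlim.eventually (gt_mem_nhds (show c < c / 2 by linarith))] with x hx hf
      rw [div_lt_iff₀ hx] at hf
      calc f x ≤ c / 2 * h x := hf.le
        _ = _ := by field_simp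
    · filter_upwards [hh, hlim.eventually (lt_mem_nhds (show 2 * c < c by linarith))] with x hx hf
      rw [lt_div_iff₀ hx] at hf
      have h3 : 0 < σ / (2 * c) := div_pos_of_neg_of_neg h1 (by linarith)
      calc σ * h x = σ / (2 * c) * (2 * c * h x) := by field_simp
        _ ≤ _ := by gcongr

/-! ### Wronskian formulas for the three derivatives, smoothness and asymptotics -/

section

variable {ν : ℝ} {k : ℕ}

theorem exists_dEss_varphi_eq (hν : -1 < ν) (k : ℕ) :
    ∃ C : ℝ, 0 < C ∧ ∀ x ∈ Ioo (0 : ℝ) 1, dEss ν (varphi ν (k + 1)) x =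
      C * x * wronskian ν (besselZero ν 1) (besselZero ν (k + 1)) x /
        besselEntire ν (besselZero ν 1 * x) ^ 2 := by
  obtain ⟨A, hA, hAe⟩ := exists_phi_eq hν 0
  obtain ⟨B, hB, hBe⟩ := exists_phi_eq hν k
  refine ⟨B / A / 2, by positivity, fun x hx => ?_⟩
  have hF := besselEntire_besselZero_one_mul_pos hν hx
  have hev : varphi ν (k + 1) =ᶠ[𝓝 x] fun y =>
      B * besselEntire ν (besselZero ν (k + 1) * y) / (A * besselEntire ν (besselZero ν 1 * y)) := by
    filter_upwards [lt_mem_nhds hx.1] with y hy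
    rw [varphi, hAe y hy, hBe y hy]
  rw [dEss, hev.deriv_eq]
  have h1 := (hasDerivAt_besselEntire_const_mul hν (besselZero ν 1) x).const_mul A
  have h2 := (hasDerivAt_besselEntire_const_mul hν (besselZero ν (k + 1)) x).const_mul B
  rw [(h2.fun_div h1 (by positivity)).deriv, wronskian]
  field_simp
  ring

/-- `R^ν` is minus the logarithmic derivative of `ϕ_1`, so adding `R^ν f` to `f'` produces the same
Wronskian as the quotient rule, with one power of `F_ν(a x)` fewer below. -/
theorem exists_dNat_phi_eq (hν : -1 < ν) (k : ℕ) :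
    ∃ C : ℝ, 0 < C ∧ ∀ x ∈ Ioo (0 : ℝ) 1, dNat ν (phi ν (k + 1)) x =
      C * x * wronskian ν (besselZero ν 1) (besselZero ν (k + 1)) x /
        besselEntire ν (besselZero ν 1 * x) := by
  obtain ⟨B, hB, hBe⟩ := exists_phi_eq hν k
  refine ⟨B / 2, by positivity, fun x hx => ?_⟩
  have hF := besselEntire_besselZero_one_mul_pos hν hx
  have hev : phi ν (k + 1) =ᶠ[𝓝 x] fun y => B * besselEntire ν (besselZero ν (k + 1) * y) := by
    filter_upwards [lt_mem_nhds hx.1] with y hy using hBe y hy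
  have h2 := (hasDerivAt_besselEntire_const_mul hν (besselZero ν (k + 1)) x).const_mul B
  rw [dNat, hev.deriv_eq, h2.deriv, hBe x hx.1, R_one_eq hν hx, wronskian]
  generalize besselEntire ν (besselZero ν 1 * x) = F at hF
  field_simp
  ring

/-- Differentiating the factor `x^{ν+1/2}` yields exactly the term that `-(ν+1/2)/x` removes. -/
theorem dLeb_psi_eq (hν : -1 < ν) (k : ℕ) {x : ℝ} (hx : x ∈ Ioo (0 : ℝ) 1) :
    dLeb ν (psi ν (k + 1)) x = x ^ (ν + 1 / 2) * dNat ν (phi ν (k + 1)) x := by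
  obtain ⟨B, hB, hBe⟩ := exists_phi_eq hν k
  have hev : phi ν (k + 1) =ᶠ[𝓝 x] fun y => B * besselEntire ν (besselZero ν (k + 1) * y) := by
    filter_upwards [lt_mem_nhds hx.1] with y hy using hBe y hy
  have h1 : HasDerivAt (phi ν (k + 1)) (deriv (phi ν (k + 1)) x) x :=
    (((hasDerivAt_besselEntire_const_mul hν _ x).const_mul B).congr_of_eventuallyEq
      hev).differentiableAt.hasDerivAt
  have h2 : HasDerivAt (fun x : ℝ => x ^ (ν + 1 / 2)) ((ν + 1 / 2) / x * x ^ (ν + 1 / 2)) x := by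
    refine (Real.hasDerivAt_rpow_const (Or.inl hx.1.ne')).congr_deriv ?_
    rw [Real.rpow_sub_one hx.1.ne']
    ring
  have h3 : deriv (psi ν (k + 1)) x = _ := (h2.fun_mul h1).deriv
  rw [dLeb, h3, dNat, psi]
  ring

theorem contDiffOn_dEss_varphi (hν : -1 < ν) (k : ℕ) :
    ContDiffOn ℝ ∞ (dEss ν (varphi ν (k + 1))) (Ioo 0 1) := by
  obtain ⟨C, -, hC⟩ := exists_dEss_varphi_eq hν k
  refine ContDiffOn.congr (ContDiffOn.div ?_ ?_ fun x hx =>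
    (pow_pos (besselEntire_besselZero_one_mul_pos hν hx) 2).ne') hC
  · exact ((contDiff_const.mul contDiff_id).mul (contDiff_wronskian hν _ _)).contDiffOn
  · exact (((contDiff_besselEntire hν).comp (contDiff_const.mul contDiff_id)).pow 2).contDiffOn

theorem contDiffOn_dNat_phi (hν : -1 < ν) (k : ℕ) :
    ContDiffOn ℝ ∞ (dNat ν (phi ν (k + 1))) (Ioo 0 1) := by
  obtain ⟨C, -, hC⟩ := exists_dNat_phi_eq hν k
  refine ContDiffOn.congr (ContDiffOn.div ?_ ?_ fun x hx =>
    (besselEntire_besselZero_one_mul_pos hν hx).ne') hC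
  · exact ((contDiff_const.mul contDiff_id).mul (contDiff_wronskian hν _ _)).contDiffOn
  · exact ((contDiff_besselEntire hν).comp (contDiff_const.mul contDiff_id)).contDiffOn

theorem contDiffOn_dLeb_psi (hν : -1 < ν) (k : ℕ) :
    ContDiffOn ℝ ∞ (dLeb ν (psi ν (k + 1))) (Ioo 0 1) :=
  ((contDiffOn_id.rpow_const_of_ne fun _ hx => hx.1.ne').mul (contDiffOn_dNat_phi hν k)).congr
    fun _ hx => dLeb_psi_eq hν k hx

theorem tendsto_besselEntire_const_mul_nhdsGT_zero (hν : -1 < ν) (a : ℝ) :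
    Tendsto (fun x => besselEntire ν (a * x)) (𝓝[>] 0) (𝓝 (besselEntire ν 0)) := by
  have h : Continuous fun x => besselEntire ν (a * x) :=
    (continuous_besselEntire hν).comp (continuous_const.mul continuous_id)
  simpa using (h.tendsto 0).mono_left (nhdsWithin_le_nhds (s := Ioi 0))

theorem wronskian_limit_zero_neg (hν : -1 < ν) (hk : 1 ≤ k) :
    (besselZero ν 1 ^ 2 - besselZero ν (k + 1) ^ 2) *
      (besselEntire (ν + 1) 0 * besselEntire ν 0) < 0 := by
  have hl := besselZero_succ_pos hν 0
  have hlt : besselZero ν 1 < besselZero ν (k + 1) := besselZero_strictMono hν (by omega)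
  have h1 : besselZero ν 1 ^ 2 < besselZero ν (k + 1) ^ 2 := by gcongr
  exact mul_neg_of_neg_of_pos (by linarith)
    (mul_pos (besselEntire_zero_pos (by linarith)) (besselEntire_zero_pos hν))

/-- Only `F_{ν+1}(λ_{k+1})` has a varying sign, `(-1)^k`, which is `(-1)^{n+1}` for `n = k + 1`. -/
theorem wronskian_limit_one_sign (hν : -1 < ν) (hk : 1 ≤ k) :
    0 < (-1) ^ (k + 1 + 1) * (2 / 3 * (besselZero ν (k + 1) ^ 2 - besselZero ν 1 ^ 2) *
      (besselZero ν 1 ^ 2 / 2 * besselEntire (ν + 1) (besselZero ν 1)) *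
        (besselZero ν (k + 1) ^ 2 / 2 * besselEntire (ν + 1) (besselZero ν (k + 1)))) := by
  have hl : 0 < besselZero ν 1 := besselZero_succ_pos hν 0
  have hm := besselZero_succ_pos hν k
  have hlt : besselZero ν 1 < besselZero ν (k + 1) := besselZero_strictMono hν (by omega)
  have h1 : 0 < besselZero ν (k + 1) ^ 2 - besselZero ν 1 ^ 2 := sub_pos.2 (by gcongr)
  have h2 := besselEntire_succ_besselZero_one_pos hν
  have h3 := (besselZero_succ_spec hν k).2.2.2
  have e : (-1) ^ (k + 1 + 1) * (2 / 3 * (besselZero ν (k + 1) ^ 2 - besselZero ν 1 ^ 2) *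
      (besselZero ν 1 ^ 2 / 2 * besselEntire (ν + 1) (besselZero ν 1)) *
        (besselZero ν (k + 1) ^ 2 / 2 * besselEntire (ν + 1) (besselZero ν (k + 1)))) =
      2 / 3 * (besselZero ν (k + 1) ^ 2 - besselZero ν 1 ^ 2) *
      (besselZero ν 1 ^ 2 / 2 * besselEntire (ν + 1) (besselZero ν 1)) *
        (besselZero ν (k + 1) ^ 2 / 2 *
          ((-1) ^ k * besselEntire (ν + 1) (besselZero ν (k + 1)))) := by
    ring
  rw [e]
  positivity

theorem simeqAlong_dEss_varphi_zero (hν : -1 < ν) (hk : 1 ≤ k) :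
    SimeqAlong (𝓝[>] 0) (dEss ν (varphi ν (k + 1))) (fun x => -x) := by
  obtain ⟨C, hC0, hC⟩ := exists_dEss_varphi_eq hν k
  have hF := besselEntire_zero_pos hν
  have hlim := ((tendsto_wronskian_zero hν (besselZero ν 1) (besselZero ν (k + 1))).const_mul C).div
    ((tendsto_besselEntire_const_mul_nhdsGT_zero hν (besselZero ν 1)).pow 2) (pow_pos hF 2).ne'
  have hneg := div_neg_of_neg_of_pos
    (mul_neg_of_pos_of_neg hC0 (wronskian_limit_zero_neg hν hk)) (pow_pos hF 2)
  have e : (fun x : ℝ => -x) = fun x => -1 * x := by simp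
  rw [e]
  refine simeqAlong_of_tendsto_div self_mem_nhdsWithin (hlim.congr' ?_) (by linarith)
  filter_upwards [Ioo_mem_nhdsGT one_pos] with x hx
  have := hx.1.ne'
  simp only [Pi.div_apply]
  rw [hC x hx]
  field_simp

theorem tendsto_dNat_phi_div_zero (hν : -1 < ν) (hk : 1 ≤ k) :
    ∃ c < 0, Tendsto (fun x => dNat ν (phi ν (k + 1)) x / x) (𝓝[>] 0) (𝓝 c) := by
  obtain ⟨C, hC0, hC⟩ := exists_dNat_phi_eq hν k
  have hF := besselEntire_zero_pos hν
  have hlim := ((tendsto_wronskian_zero hν (besselZero ν 1) (besselZero ν (k + 1))).const_mul C).div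
    (tendsto_besselEntire_const_mul_nhdsGT_zero hν (besselZero ν 1)) hF.ne'
  refine ⟨_, div_neg_of_neg_of_pos
    (mul_neg_of_pos_of_neg hC0 (wronskian_limit_zero_neg hν hk)) hF, hlim.congr' ?_⟩
  filter_upwards [Ioo_mem_nhdsGT one_pos] with x hx
  have := hx.1.ne'
  simp only [Pi.div_apply]
  rw [hC x hx]
  field_simp

theorem simeqAlong_dNat_phi_zero (hν : -1 < ν) (hk : 1 ≤ k) :
    SimeqAlong (𝓝[>] 0) (dNat ν (phi ν (k + 1))) (fun x => -x) := by
  obtain ⟨c, hc, hlim⟩ := tendsto_dNat_phi_div_zero hν hk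
  have e : (fun x : ℝ => -x) = fun x => -1 * x := by simp
  rw [e]
  exact simeqAlong_of_tendsto_div self_mem_nhdsWithin hlim (by linarith)

theorem simeqAlong_dLeb_psi_zero (hν : -1 < ν) (hk : 1 ≤ k) :
    SimeqAlong (𝓝[>] 0) (dLeb ν (psi ν (k + 1))) (fun x => -x ^ (ν + 3 / 2)) := by
  obtain ⟨c, hc, hlim⟩ := tendsto_dNat_phi_div_zero hν hk
  have e : (fun x : ℝ => -x ^ (ν + 3 / 2)) = fun x => -1 * x ^ (ν + 3 / 2) := by simp
  rw [e]
  refine simeqAlong_of_tendsto_div (c := c) ?_ (hlim.congr' ?_) (by linarith)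
  · filter_upwards [self_mem_nhdsWithin] with x hx using Real.rpow_pos_of_pos hx _
  · filter_upwards [Ioo_mem_nhdsGT one_pos] with x hx
    have h1 : x ^ (ν + 3 / 2) = x ^ (ν + 1 / 2) * x := by
      rw [← Real.rpow_add_one hx.1.ne']
      ring_nf
    rw [dLeb_psi_eq hν k hx, h1, mul_div_mul_left _ _ (Real.rpow_pos_of_pos hx.1 _).ne']

theorem tendsto_id_nhdsLT_one : Tendsto (fun x : ℝ => x) (𝓝[<] 1) (𝓝 1) :=
  tendsto_id.mono_left nhdsWithin_le_nhds

/-- The numerator vanishes to order three and `F_ν(a x)^2` to order two, which leaves order one. -/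
theorem simeqAlong_dEss_varphi_one (hν : -1 < ν) (hk : 1 ≤ k) :
    SimeqAlong (𝓝[<] 1) (dEss ν (varphi ν (k + 1))) (fun x => (-1) ^ (k + 1 + 1) * (1 - x)) := by
  obtain ⟨C, hC0, hC⟩ := exists_dEss_varphi_eq hν k
  have hl : 0 < besselZero ν 1 := besselZero_succ_pos hν 0
  have hF1 := (besselZero_succ_spec hν 0).2.1
  have hD : 0 < besselZero ν 1 ^ 2 / 2 * besselEntire (ν + 1) (besselZero ν 1) :=
    mul_pos (by positivity) (besselEntire_succ_besselZero_one_pos hν)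
  have hlim := ((tendsto_id_nhdsLT_one.const_mul C).mul (tendsto_wronskian_div_one_sub_pow hν hl.ne'
    (besselZero_succ_pos hν k).ne' hF1 (besselZero_succ_spec hν k).2.1)).div
    ((tendsto_besselEntire_div_one_sub hν hF1).pow 2) (pow_pos hD 2).ne'
  refine simeqAlong_of_tendsto_div ?_ (hlim.congr' ?_) ?_
  · filter_upwards [self_mem_nhdsWithin] with x hx using sub_pos.2 hx
  · filter_upwards [Ioo_mem_nhdsLT one_pos] with x hx
    have := (sub_pos.2 hx.2).ne'
    have := (besselEntire_besselZero_one_mul_pos hν hx).ne'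
    simp only [Pi.div_apply, zero_add]
    rw [hC x hx]
    field_simp
  · rw [mul_one, ← mul_div_assoc, mul_left_comm]
    exact div_pos (mul_pos hC0 (wronskian_limit_one_sign hν hk)) (pow_pos hD 2)

/-- Order three over order one leaves order two. Stating a limit rather than a comparison lets the
Lebesgue case reuse it after multiplication by `x^{ν+1/2}`. -/
theorem tendsto_dNat_phi_div_one (hν : -1 < ν) (hk : 1 ≤ k) :
    ∃ c, 0 < (-1) ^ (k + 1 + 1) * c ∧
      Tendsto (fun x => dNat ν (phi ν (k + 1)) x / (1 - x) ^ 2) (𝓝[<] 1) (𝓝 c) := by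
  obtain ⟨C, hC0, hC⟩ := exists_dNat_phi_eq hν k
  have hl : 0 < besselZero ν 1 := besselZero_succ_pos hν 0
  have hF1 := (besselZero_succ_spec hν 0).2.1
  have hD : 0 < besselZero ν 1 ^ 2 / 2 * besselEntire (ν + 1) (besselZero ν 1) :=
    mul_pos (by positivity) (besselEntire_succ_besselZero_one_pos hν)
  have hlim := ((tendsto_id_nhdsLT_one.const_mul C).mul (tendsto_wronskian_div_one_sub_pow hν hl.ne'
    (besselZero_succ_pos hν k).ne' hF1 (besselZero_succ_spec hν k).2.1)).div
    (tendsto_besselEntire_div_one_sub hν hF1) hD.ne'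
  refine ⟨_, ?_, hlim.congr' ?_⟩
  · rw [mul_one, ← mul_div_assoc, mul_left_comm]
    exact div_pos (mul_pos hC0 (wronskian_limit_one_sign hν hk)) hD
  · filter_upwards [Ioo_mem_nhdsLT one_pos] with x hx
    have := (sub_pos.2 hx.2).ne'
    have := (besselEntire_besselZero_one_mul_pos hν hx).ne'
    simp only [Pi.div_apply, zero_add]
    rw [hC x hx]
    field_simp

theorem simeqAlong_dNat_phi_one (hν : -1 < ν) (hk : 1 ≤ k) :
    SimeqAlong (𝓝[<] 1) (dNat ν (phi ν (k + 1)))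
      (fun x => (-1) ^ (k + 1 + 1) * (1 - x) ^ 2) := by
  obtain ⟨c, hc, hlim⟩ := tendsto_dNat_phi_div_one hν hk
  refine simeqAlong_of_tendsto_div ?_ hlim hc
  filter_upwards [self_mem_nhdsWithin] with x hx using pow_pos (sub_pos.2 hx) 2

theorem simeqAlong_dLeb_psi_one (hν : -1 < ν) (hk : 1 ≤ k) :
    SimeqAlong (𝓝[<] 1) (dLeb ν (psi ν (k + 1)))
      (fun x => (-1) ^ (k + 1 + 1) * (1 - x) ^ 2) := by
  obtain ⟨c, hc, hlim⟩ := tendsto_dNat_phi_div_one hν hk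
  have hpow : Tendsto (fun x : ℝ => x ^ (ν + 1 / 2)) (𝓝[<] 1) (𝓝 1) := by
    have := (Real.continuousAt_rpow_const 1 (ν + 1 / 2) (Or.inl one_ne_zero)).tendsto
    rw [Real.one_rpow] at this
    exact this.mono_left nhdsWithin_le_nhds
  have hlim' := hpow.mul hlim
  rw [one_mul] at hlim'
  refine simeqAlong_of_tendsto_div ?_ (hlim'.congr' ?_) hc
  · filter_upwards [self_mem_nhdsWithin] with x hx using pow_pos (sub_pos.2 hx) 2
  · filter_upwards [Ioo_mem_nhdsLT one_pos] with x hx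
    rw [dLeb_psi_eq hν k hx, mul_div_assoc]

end

end FourierBessel

theorem mainTheorem11 (ν : ℝ) (hν : -1 < ν) (n : ℕ) (hn : 2 ≤ n) :
    (ContDiffOn ℝ ∞ (FourierBessel.dEss ν (FourierBessel.varphi ν n)) (Ioo 0 1) ∧
      ContDiffOn ℝ ∞ (FourierBessel.dNat ν (FourierBessel.phi ν n)) (Ioo 0 1) ∧
      ContDiffOn ℝ ∞ (FourierBessel.dLeb ν (FourierBessel.psi ν n)) (Ioo 0 1)) ∧
    (FourierBessel.SimeqAlong (𝓝[>] 0) (FourierBessel.dEss ν (FourierBessel.varphi ν n))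
        (fun x => -x) ∧
      FourierBessel.SimeqAlong (𝓝[<] 1) (FourierBessel.dEss ν (FourierBessel.varphi ν n))
        (fun x => (-1) ^ (n + 1) * (1 - x))) ∧
    (FourierBessel.SimeqAlong (𝓝[>] 0) (FourierBessel.dNat ν (FourierBessel.phi ν n))
        (fun x => -x) ∧
      FourierBessel.SimeqAlong (𝓝[<] 1) (FourierBessel.dNat ν (FourierBessel.phi ν n))
        (fun x => (-1) ^ (n + 1) * (1 - x) ^ 2)) ∧
    (FourierBessel.SimeqAlong (𝓝[>] 0) (FourierBessel.dLeb ν (FourierBessel.psi ν n))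
        (fun x => -x ^ (ν + 3 / 2)) ∧
      FourierBessel.SimeqAlong (𝓝[<] 1) (FourierBessel.dLeb ν (FourierBessel.psi ν n))
        (fun x => (-1) ^ (n + 1) * (1 - x) ^ 2)) := by
  -- Genuine zeros carry successor indices; `1 ≤ k` is what gives `λ_1 < λ_n`, hence a nonzero
  -- Wronskian.
  obtain ⟨k, rfl⟩ : ∃ k, n = k + 1 := ⟨n - 1, by omega⟩
  have hk : 1 ≤ k := by omega
  open FourierBessel in
  exact ⟨⟨contDiffOn_dEss_varphi hν k, contDiffOn_dNat_phi hν k, contDiffOn_dLeb_psi hν k⟩,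
    ⟨simeqAlong_dEss_varphi_zero hν hk, simeqAlong_dEss_varphi_one hν hk⟩,
    ⟨simeqAlong_dNat_phi_zero hν hk, simeqAlong_dNat_phi_one hν hk⟩,
    ⟨simeqAlong_dLeb_psi_zero hν hk, simeqAlong_dLeb_psi_one hν hk⟩⟩
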